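/- **Setting.** Fix a function-free first-order vocabulary with finitely many (and at least one) constants, whose predicate symbols are partitioned into probabilistic and derived ones. An LPAD $\mathcal P$ consists of finitely many probabilistic clauses $h_1:p_1;\ldots;h_n:p_n\leftarrow B$ (the $h_i$ are probabilistic atoms, $p_i\in[0,1]$, $\sum_i p_i=1$, $B$ is a finite conjunction of literals) and finitely many normal clauses $h\leftarrow B$ with $h$ a derived atom. An atomic choice is a triple $(c,\theta,i)$ with $c$ a probabilistic clause with $n$ heads, $\theta$ a grounding substitution for the variables of $c$, and $1\le i\le n$. A set of atomic choices is consistent (a composite choice) if it does not contain $(c,\theta,i)$ and $(c,\theta,j)$ with $i\neq j$; it is a selection if moreover it contains an atomic choice for every $(c,\theta)$. The world $\omega_s$ of a selection $s$ consists of the ground clauses $(h_i\leftarrow B)\theta$ with $(c,\theta,i)\in s$ and of all ground instances of the normal clauses. $\mathcal P$ is *sound* if, for each selection $s$, the well-founded model of $\omega_s$ is two-valued and is the unique stable model of $\omega_s$; $\omega_s\models Q$ means that the ground query (list of ground literals) $Q$ is true in this model. **Choice expressions.** These are built from $\bot$, $\top$ and atomic choices with $\neg,\wedge,\vee$. For a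 set $K$ of sets of atomic choices, let $\mathsf{mins}(K)$ be the set of consistent members of $K$ that have no proper subset in $K$. Let $\overline{(c,\theta,i)}=\{(c,\theta,j)\mid j\ne i\}$, $\overline\kappa=\bigcup_{\alpha\in\kappa}\overline\alpha$, and let $\mathsf{duals}(K)=\mathsf{mins}(H)$, where $H$ is the set of all sets obtained by picking exactly one element from each member of $\{\overline\kappa\mid\kappa\in K\}$. Put $K_1\otimes K_2=\mathsf{mins}\{\kappa_1\cup\kappa_2\mid\kappa_i\in K_i\}$. Then $\gamma(\bot)=\emptyset$, $\gamma(\top)=\{\emptyset\}$, $\gamma(\alpha)=\{\{\alpha\}\}$, $\gamma(\neg C)=\mathsf{duals}(\gamma(C))$, $\gamma(C\wedge D)=\mathsf{mins}(\gamma(C)\otimes\gamma(D))$, $\gamma(C\vee D)=\mathsf{mins}(\gamma(C)\cup\gamma(D))$. A value of $\mathsf{dnf}(C)$ is obtained from $C$ by rewriting to a normal form with $\neg\neg C\to C$, De Morgan's laws and the distribution of $\wedge$ over $\vee$, and then rewriting to a normal form, modulo associativity and commutativity of $\wedge,\vee$, with $\alpha\wedge\beta\to\bot$ and $\alpha\wedge\neg\beta\to\alpha$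 (both for $\alpha\in\overline\beta$), $C\wedge\neg C\to\bot$, $C\wedge\top\to C$, $C\wedge\bot\to\bot$, $C\vee\top\to\top$, $C\vee(C\wedge D)\to C$, $C\wedge C\to C$. **SLPDNF-trees.** A (completely extended) SLPDNF-tree for a ground query $Q_0$ is a finite or infinite tree with root $\langle Q_0,\top\rangle$. Each node $\langle\Box,C\rangle$ with the empty query is a leaf, marked as success; in each other node $\langle Q,C\rangle$ a literal of $Q$ is selected, and its children are as follows. If the selected literal is a derived atom $a$, there is a child $\langle Q',C\rangle$ for each ground instance $a\leftarrow B$ of a normal clause, where $Q'$ is $Q$ with $a$ replaced by $B$. If it is a probabilistic atom $a$, there is a child $\langle Q',C'\rangle$ for each atomic choice $(c,\theta,i)$ with $h_i\theta=a$ and $C'=\mathsf{dnf}(C\wedge(c,\theta,i))\neq\bot$, where $Q'$ is $Q$ with $a$ replaced by $B\theta$. If it is $\neg a$, the node has a subsidiary tree, which is a completely extended SLPDNF-tree for $a$ with finitely many success leaves, whose expressions are $C_1,\ldots,C_n$ ($n\geq0$); the node has the single child $\langle Q',C'\rangle$, where $Q'$ is $Q$ without $\neg a$, $C_a=\mathsf{dnf}(\neg(C_1\vee\cdots\vee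 C_n))$ (the empty disjunction is $\bot$) and $C'=\mathsf{dnf}(C\wedge C_a)$, if $C'\ne\bot$, and no child otherwise. The nesting of subsidiary trees is well-founded. For such a tree, $\mathsf{expl}_{\mathcal P}(Q_0)$ is the union of the sets $\gamma(C)$ over the success leaves $\langle\Box,C\rangle$ of the main tree. **Theorem.** Let $\mathcal P$ be a sound LPAD, let $Q$ be a ground query, and let $\mathsf{expl}_{\mathcal P}(Q)$ be computed by any completely extended SLPDNF-tree for $Q$. Then, for every selection $s$, $$\omega_s\models Q\iff\text{there is }\kappa\in\mathsf{expl}_{\mathcal P}(Q)\text{ with }\kappa\subseteq s.$$ Moreover, $\mathsf{expl}_{\mathcal P}(Q)$ is finite; each $\kappa\in\mathsf{expl}_{\mathcal P}(Q)$ is an explanation of $Q$, i.e. a composite choice such that $\omega_s\models Q$ for every selection $s\supseteq\kappa$; and $\mathsf{expl}_{\mathcal P}(Q)$ is covering for $Q$, i.e. every world in which $Q$ is true is $\omega_s$ for some selection $s$ that extends some $\kappa\in\mathsf{expl}_{\mathcal P}(Q)$. -/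

import Mathlib

namespace SLPDNF

universe u v w

/-! ## Function-free first-order vocabulary -/

/-- A function-free vocabulary: predicate symbols with arities, split into probabilistic
predicates (the set `probabilistic`) and derived predicates (its complement), a finite nonempty
set of constants, and variables. -/
structure Vocabulary where
  Pred : Type u
  arity : Pred → ℕ
  probabilistic : Set Pred
  Const : Type v
  Var : Type w
  const_finite : Finite Const
  const_nonempty : Nonempty Const

/-- Terms of a function-free language. -/
inductive Term (S : Vocabulary.{u, v, w}) : Type (max v w)
  | const (k : S.Const) : Term S
  | var (x : S.Var) : Term S

/-- Atoms `f(t₁, …, tₙ)` whose arguments are taken from `τ`. With `τ = Term S` these are the atoms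
of the language, with `τ = S.Const` the ground atoms. -/
structure Atom (S : Vocabulary.{u, v, w}) (τ : Type*) where
  pred : S.Pred
  args : Fin (S.arity pred) → τ

inductive Literal (S : Vocabulary.{u, v, w}) (τ : Type*)
  | pos (a : Atom S τ) : Literal S τ
  | neg (a : Atom S τ) : Literal S τ

/-- A query `l₁, …, lₙ` (a conjunction of literals); `[]` is the empty query. -/
abbrev Query (S : Vocabulary.{u, v, w}) (τ : Type*) := List (Literal S τ)

/-- A normal clause `head ← body`. -/
structure Clause (S : Vocabulary.{u, v, w}) (τ : Type*) where
  head : Atom S τ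
  body : Query S τ

abbrev GroundAtom (S : Vocabulary.{u, v, w}) := Atom S S.Const
abbrev GroundLiteral (S : Vocabulary.{u, v, w}) := Literal S S.Const
abbrev GroundQuery (S : Vocabulary.{u, v, w}) := Query S S.Const
abbrev GroundClause (S : Vocabulary.{u, v, w}) := Clause S S.Const

section Grounding

variable {S : Vocabulary.{u, v, w}}

/-- The instance of a term under an assignment of constants to variables. -/
def Term.inst (ν : S.Var → S.Const) : Term S → S.Const
  | .const k => k
  | .var x => ν x

def Atom.inst (ν : S.Var → S.Const) (a : Atom S (Term S)) : GroundAtom S :=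
  ⟨a.pred, fun i => (a.args i).inst ν⟩

def Literal.inst (ν : S.Var → S.Const) : Literal S (Term S) → GroundLiteral S
  | .pos a => .pos (a.inst ν)
  | .neg a => .neg (a.inst ν)

def Clause.inst (ν : S.Var → S.Const) (r : Clause S (Term S)) : GroundClause S :=
  ⟨r.head.inst ν, r.body.map (Literal.inst ν)⟩

/-- The variables of an atom. -/
def Atom.vars (a : Atom S (Term S)) : Set S.Var := {x | ∃ i, a.args i = .var x}

def Literal.vars : Literal S (Term S) → Set S.Var
  | .pos a => a.vars
  | .neg a => a.vars

end Grounding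

/-! ## LPADs -/

/-- A probabilistic clause `h₁ : p₁; …; hₙ : pₙ ← B`, with the probabilities summing to one (the
special atom `none`, if it is needed, is listed explicitly among the heads). -/
structure ProbClause (S : Vocabulary.{u, v, w}) where
  heads : List (Atom S (Term S) × ℝ)
  body : Query S (Term S)
  prob_mem : ∀ h ∈ heads, 0 ≤ h.2 ∧ h.2 ≤ 1
  prob_sum : (heads.map Prod.snd).sum = 1

/-- The variables of a probabilistic clause. -/
def ProbClause.vars {S : Vocabulary.{u, v, w}} (c : ProbClause S) : Set S.Var :=
  {x | (∃ h ∈ c.heads, x ∈ h.1.vars) ∨ ∃ l ∈ c.body, x ∈ l.vars}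

/-- A logic program with annotated disjunctions: finitely many probabilistic clauses, whose heads
are probabilistic atoms, and finitely many normal clauses, whose heads are derived atoms. -/
structure LPAD (S : Vocabulary.{u, v, w}) where
  probClauses : Finset (ProbClause S)
  derivedClauses : Finset (Clause S (Term S))
  prob_heads : ∀ c ∈ probClauses, ∀ h ∈ c.heads, h.1.pred ∈ S.probabilistic
  derived_heads : ∀ r ∈ derivedClauses, r.head.pred ∉ S.probabilistic

section Choices

variable {S : Vocabulary.{u, v, w}}

/-- A grounding `cθ` of a probabilistic clause `c` of the program: the clause together with a
ground substitution `θ` whose domain is the set of variables of `c`. -/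
abbrev Grounding (P : LPAD S) := Σ c : {c // c ∈ P.probClauses}, (c.1.vars → S.Const)

/-- An atomic choice `(c, θ, i)`. -/
abbrev AtomicChoice (P : LPAD S) := Σ g : Grounding P, Fin g.1.1.heads.length

variable {P : LPAD S}

open Classical in
/-- A total assignment that agrees with `θ`; its values outside the variables of the clause do not
occur in the instance. -/
noncomputable def Grounding.assignment (g : Grounding P) : S.Var → S.Const := fun x =>
  if h : x ∈ g.1.1.vars then g.2 ⟨x, h⟩ else Classical.choice S.const_nonempty

/-- The ground normal clause `(hᵢ ← B)θ` chosen by the atomic choice `(c, θ, i)`. -/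
noncomputable def AtomicChoice.clause (α : AtomicChoice P) : GroundClause S :=
  Clause.inst (Grounding.assignment α.1) ⟨(α.1.1.1.heads.get α.2).1, α.1.1.1.body⟩

/-- `IsAlternative α β`: the atomic choices are `(c, θ, i)` and `(c, θ, j)` with `i ≠ j`. -/
def IsAlternative (α β : AtomicChoice P) : Prop := α.1 = β.1 ∧ α ≠ β

/-- The complement of an atomic choice: all its alternatives. -/
def AtomicChoice.compl (α : AtomicChoice P) : Set (AtomicChoice P) := {β | IsAlternative α β}

/-- A set of atomic choices is consistent if it does not contain two different atomic choices for
the same grounding; a consistent set is called a composite choice. -/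
def Consistent (κ : Set (AtomicChoice P)) : Prop :=
  ∀ α ∈ κ, ∀ β ∈ κ, ¬ IsAlternative α β

/-- A selection: a composite choice with an atomic choice for each grounding of each
probabilistic clause. -/
def IsSelection (s : Set (AtomicChoice P)) : Prop :=
  Consistent s ∧ ∀ g : Grounding P, ∃ α ∈ s, α.1 = g

/-- The ground instances of the normal clauses of the program. -/
def LPAD.groundDerived (P : LPAD S) : Set (GroundClause S) :=
  {r | ∃ c ∈ P.derivedClauses, ∃ ν : S.Var → S.Const, r = c.inst ν}

/-- The (grounding of the) world `ω_s`. -/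
def LPAD.world (P : LPAD S) (s : Set (AtomicChoice P)) : Set (GroundClause S) :=
  {r | ∃ α ∈ s, r = AtomicChoice.clause α} ∪ P.groundDerived

end Choices

/-! ## Well-founded and stable models of ground normal programs -/

section Models

variable {S : Vocabulary.{u, v, w}}

/-- A three-valued interpretation: the set of true atoms and the set of false atoms. -/
abbrev Interp (S : Vocabulary.{u, v, w}) := Set (GroundAtom S) × Set (GroundAtom S)

def Literal.TrueIn (I : Interp S) : GroundLiteral S → Prop
  | .pos a => a ∈ I.1
  | .neg a => a ∈ I.2

def Literal.FalseIn (I : Interp S) : GroundLiteral S → Prop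
  | .pos a => a ∈ I.2
  | .neg a => a ∈ I.1

theorem Literal.TrueIn.mono {I J : Interp S} (h : I ≤ J) {l : GroundLiteral S}
    (hl : l.TrueIn I) : l.TrueIn J := by
  cases l with
  | pos a => exact h.1 hl
  | neg a => exact h.2 hl

theorem Literal.FalseIn.mono {I J : Interp S} (h : I ≤ J) {l : GroundLiteral S}
    (hl : l.FalseIn I) : l.FalseIn J := by
  cases l with
  | pos a => exact h.2 hl
  | neg a => exact h.1 hl

/-- Atoms that follow from `I` by one application of a clause. -/
def immediate (p : Set (GroundClause S)) (I : Interp S) : Set (GroundAtom S) :=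
  {a | ∃ r ∈ p, r.head = a ∧ ∀ l ∈ r.body, l.TrueIn I}

/-- `U` is an unfounded set of the program with respect to `I`. -/
def IsUnfounded (p : Set (GroundClause S)) (I : Interp S) (U : Set (GroundAtom S)) : Prop :=
  ∀ a ∈ U, ∀ r ∈ p, r.head = a →
    (∃ l ∈ r.body, l.FalseIn I) ∨ ∃ b ∈ U, Literal.pos b ∈ r.body

/-- The operator whose least fixed point is the well-founded model: it adds the immediate
consequences as true atoms and the greatest unfounded set as false atoms. -/
def wfOp (p : Set (GroundClause S)) : Interp S →o Interp S where
  toFun I := (immediate p I, ⋃₀ {U | IsUnfounded p I U})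
  monotone' := by
    intro I J h
    constructor
    · rintro a ⟨r, hr, ha, hb⟩
      exact ⟨r, hr, ha, fun l hl => (hb l hl).mono h⟩
    · rintro a ⟨U, hU, ha⟩
      refine ⟨U, fun b hb r hr hrb => ?_, ha⟩
      rcases hU b hb r hr hrb with ⟨l, hl, hf⟩ | h'
      · exact Or.inl ⟨l, hl, hf.mono h⟩
      · exact Or.inr h'

/-- The (three-valued) well-founded model. -/
def wfm (p : Set (GroundClause S)) : Interp S := OrderHom.lfp (wfOp p)

/-- Truth of a literal in a two-valued interpretation. -/
def Literal.HoldsIn (M : Set (GroundAtom S)) : GroundLiteral S → Prop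
  | .pos a => a ∈ M
  | .neg a => a ∉ M

def Literal.isPos {τ : Type*} : Literal S τ → Bool
  | .pos _ => true
  | .neg _ => false

/-- The Gelfond–Lifschitz reduct. -/
def reduct (p : Set (GroundClause S)) (M : Set (GroundAtom S)) : Set (GroundClause S) :=
  {r' | ∃ r ∈ p, (∀ a, Literal.neg a ∈ r.body → a ∉ M) ∧
    r' = ⟨r.head, r.body.filter Literal.isPos⟩}

/-- The intersection of all models; for a negation-free program this is its least model. -/
def leastModel (p : Set (GroundClause S)) : Set (GroundAtom S) :=
  ⋂₀ {N | ∀ r ∈ p, (∀ l ∈ r.body, l.HoldsIn N) → r.head ∈ N}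

def IsStableModel (p : Set (GroundClause S)) (M : Set (GroundAtom S)) : Prop :=
  M = leastModel (reduct p M)

/-- `p ⊨ Q`: the ground query is true in the well-founded model. -/
def Satisfies (p : Set (GroundClause S)) (Q : GroundQuery S) : Prop :=
  ∀ l ∈ Q, l.TrueIn (wfm p)

/-- A sound program: the well-founded model of each world is two-valued, and it is the unique
stable model of that world. -/
def LPAD.Sound (P : LPAD S) : Prop :=
  ∀ s : Set (AtomicChoice P), IsSelection s →
    (wfm (P.world s)).2 = (wfm (P.world s)).1ᶜ ∧
      ∀ M, IsStableModel (P.world s) M ↔ M = (wfm (P.world s)).1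

end Models

/-! ## Sets of composite choices and choice expressions -/

section Expressions

variable {S : Vocabulary.{u, v, w}} {P : LPAD S}

/-- Removal of inconsistent and redundant elements. -/
def mins (K : Set (Set (AtomicChoice P))) : Set (Set (AtomicChoice P)) :=
  {κ | κ ∈ K ∧ Consistent κ ∧ ∀ κ' ∈ K, ¬ κ' ⊂ κ}

/-- All sets obtained by picking exactly one element from each member of `𝒮`. -/
def hits (𝒮 : Set (Set (AtomicChoice P))) : Set (Set (AtomicChoice P)) :=
  {H | ∃ f : 𝒮 → AtomicChoice P, (∀ X : 𝒮, f X ∈ X.1) ∧ H = Set.range f}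

/-- `κ̄`: the union of the complements of the atomic choices in `κ`. -/
def complChoice (κ : Set (AtomicChoice P)) : Set (AtomicChoice P) :=
  ⋃ α ∈ κ, AtomicChoice.compl α

def duals (K : Set (Set (AtomicChoice P))) : Set (Set (AtomicChoice P)) :=
  mins (hits (complChoice '' K))

/-- The operation `K₁ ⊗ K₂`. -/
def otimes (K₁ K₂ : Set (Set (AtomicChoice P))) : Set (Set (AtomicChoice P)) :=
  mins {κ | ∃ κ₁ ∈ K₁, ∃ κ₂ ∈ K₂, κ = κ₁ ∪ κ₂}

/-- Choice expressions over the atomic choices of the program. -/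
inductive ChoiceExpr (P : LPAD S)
  | bot : ChoiceExpr P
  | top : ChoiceExpr P
  | atom (α : AtomicChoice P) : ChoiceExpr P
  | neg (C : ChoiceExpr P) : ChoiceExpr P
  | and (C D : ChoiceExpr P) : ChoiceExpr P
  | or (C D : ChoiceExpr P) : ChoiceExpr P

/-- The set of composite choices represented by a choice expression. -/
def gamma : ChoiceExpr P → Set (Set (AtomicChoice P))
  | .bot => ∅
  | .top => {∅}
  | .atom α => {{α}}
  | .neg C => duals (gamma C)
  | .and C D => mins (otimes (gamma C) (gamma D))
  | .or C D => mins (gamma C ∪ gamma D)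

/-- Closure of a relation on choice expressions under contexts (rewriting inside a term). -/
inductive Rewrite (R : ChoiceExpr P → ChoiceExpr P → Prop) : ChoiceExpr P → ChoiceExpr P → Prop
  | root {C D} : R C D → Rewrite R C D
  | neg {C D} : Rewrite R C D → Rewrite R (.neg C) (.neg D)
  | andLeft {C D} (E) : Rewrite R C D → Rewrite R (.and C E) (.and D E)
  | andRight {C D} (E) : Rewrite R C D → Rewrite R (.and E C) (.and E D)
  | orLeft {C D} (E) : Rewrite R C D → Rewrite R (.or C E) (.or D E)
  | orRight {C D} (E) : Rewrite R C D → Rewrite R (.or E C) (.or E D)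

/-- Associativity and commutativity of `∧` and `∨`. -/
inductive ACRule : ChoiceExpr P → ChoiceExpr P → Prop
  | andAssoc (C D E) : ACRule (.and C (.and D E)) (.and (.and C D) E)
  | andComm (C D) : ACRule (.and C D) (.and D C)
  | orAssoc (C D E) : ACRule (.or C (.or D E)) (.or (.or C D) E)
  | orComm (C D) : ACRule (.or C D) (.or D C)

/-- Equality modulo associativity and commutativity of `∧` and `∨`. -/
def ACEq : ChoiceExpr P → ChoiceExpr P → Prop := Relation.EqvGen (Rewrite ACRule)

/-- The simplification rules that implement `mins` on choice expressions. -/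
inductive MinsRule : ChoiceExpr P → ChoiceExpr P → Prop
  | clash (α β : AtomicChoice P) : IsAlternative α β →
      MinsRule (.and (.atom α) (.atom β)) .bot
  | specific (α β : AtomicChoice P) : IsAlternative α β →
      MinsRule (.and (.atom α) (.neg (.atom β))) (.atom α)
  | andNeg (C) : MinsRule (.and C (.neg C)) .bot
  | andTop (C) : MinsRule (.and C .top) C
  | andBot (C) : MinsRule (.and C .bot) .bot
  | orTop (C) : MinsRule (.or C .top) .top
  | absorb (C D) : MinsRule (.or C (.and C D)) C
  | andSelf (C) : MinsRule (.and C C) C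

/-- One simplification step modulo associativity and commutativity. -/
def MinsStep (C D : ChoiceExpr P) : Prop :=
  ∃ C' D', ACEq C C' ∧ Rewrite MinsRule C' D' ∧ ACEq D' D

/-- The rewrite rules towards disjunctive normal form. -/
inductive DnfRule : ChoiceExpr P → ChoiceExpr P → Prop
  | negNeg (C) : DnfRule (.neg (.neg C)) C
  | negOr (C D) : DnfRule (.neg (.or C D)) (.and (.neg C) (.neg D))
  | negAnd (C D) : DnfRule (.neg (.and C D)) (.or (.neg C) (.neg D))
  | distribLeft (C D E) : DnfRule (.and C (.or D E)) (.or (.and C D) (.and C E))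
  | distribRight (C D E) : DnfRule (.and (.or C D) E) (.or (.and C E) (.and D E))

/-- `D` is a normal form of `C` for the relation `R`. -/
def IsNormalFormOf (R : ChoiceExpr P → ChoiceExpr P → Prop) (C D : ChoiceExpr P) : Prop :=
  Relation.ReflTransGen R C D ∧ ∀ E, ¬ R D E

/-- `D` is a value of `dnf(C)`: normalise with the rules towards disjunctive normal form, then
simplify. -/
def IsDnf (C D : ChoiceExpr P) : Prop :=
  ∃ C', IsNormalFormOf (Rewrite DnfRule) C C' ∧ IsNormalFormOf MinsStep C' D

/-- The disjunction `C₁ ∨ … ∨ Cₙ`, which is `⊥` for `n = 0`. -/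
def disj : List (ChoiceExpr P) → ChoiceExpr P
  | [] => .bot
  | [C] => C
  | C :: D :: L => .or C (disj (D :: L))

end Expressions

/-! ## SLPDNF-trees -/

section Trees

variable {S : Vocabulary.{u, v, w}}

/-- Resolution steps with respect to the grounding of the program: with a ground instance of a
normal clause, with a ground probabilistic clause and one of its heads, or on a negative
literal. -/
inductive Step (P : LPAD S)
  | derived (r : GroundClause S) : Step P
  | choice (α : AtomicChoice P) : Step P
  | negative : Step P

/-- A node label `⟨Q, C⟩`. -/
structure NodeLabel (P : LPAD S) where
  query : GroundQuery S
  expr : ChoiceExpr P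

/-- The address of a node: the steps that lead to it from the root `[]`, the last one first. -/
abbrev Address (P : LPAD S) := List (Step P)

/-- A (finite or infinite) tree with node labels and a selected literal position at each node;
`label x = none` means that there is no node with address `x`. -/
structure Tree (P : LPAD S) where
  label : Address P → Option (NodeLabel P)
  sel : Address P → ℕ

variable {P : LPAD S}

/-- Replacement of the `k`-th literal of a query by the query `B`. -/
def replaceAt (Q : GroundQuery S) (k : ℕ) (B : GroundQuery S) : GroundQuery S :=
  Q.take k ++ B ++ Q.drop (k + 1)

/-- `T` has a node at `x` labelled `⟨Q, C⟩` in which the literal `l` is selected. -/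
def Tree.Selects (T : Tree P) (x : Address P) (Q : GroundQuery S) (C : ChoiceExpr P)
    (l : GroundLiteral S) : Prop :=
  T.label x = some ⟨Q, C⟩ ∧ Q[T.sel x]? = some l

/-- `T` has at `x` a leaf marked as success, with choice expression `C`. -/
def Tree.IsSuccess (T : Tree P) (x : Address P) (C : ChoiceExpr P) : Prop :=
  T.label x = some ⟨[], C⟩

/-- The address `x` carries the label `⟨Q, C'⟩`, where `C'` is a value of `dnf(C)`, or no node if
that value is `⊥`. -/
def Tree.LabelUnlessBot (T : Tree P) (x : Address P) (Q : GroundQuery S)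
    (C : ChoiceExpr P) : Prop :=
  ∃ C', IsDnf C C' ∧
    ((C' = .bot ∧ T.label x = none) ∨ (C' ≠ .bot ∧ T.label x = some ⟨Q, C'⟩))

/-- `IsSLPDNFTree Q T`: `T` is the main tree of a completely extended SLPDNF-tree for the ground
query `Q`, computed with respect to the grounding of the program. The function `subs` gives the
subsidiary trees, which are themselves completely extended, and `leaves x` lists the success
leaves of the tree `subs x`. A node without children whose query is not empty is marked as
failed. -/
inductive IsSLPDNFTree : GroundQuery S → Tree P → Prop
  | mk (Q₀ : GroundQuery S) (T : Tree P)
      (subs : Address P → Tree P)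
      (leaves : Address P → List (Address P × ChoiceExpr P))
      (root : T.label [] = some ⟨Q₀, .top⟩)
      (orphan : ∀ x e, T.label x = none → T.label (e :: x) = none)
      (success : ∀ x C e, T.IsSuccess x C → T.label (e :: x) = none)
      (selected : ∀ x Q C, T.label x = some ⟨Q, C⟩ → Q ≠ [] → ∃ l, T.Selects x Q C l)
      (derived_atom : ∀ x Q C a, T.Selects x Q C (.pos a) → a.pred ∉ S.probabilistic →
        (∀ r, r ∈ P.groundDerived → r.head = a →
          T.label (.derived r :: x) = some ⟨replaceAt Q (T.sel x) r.body, C⟩) ∧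
        (∀ r, ¬ (r ∈ P.groundDerived ∧ r.head = a) → T.label (.derived r :: x) = none) ∧
        (∀ α, T.label (.choice α :: x) = none) ∧
        T.label (.negative :: x) = none)
      (probabilistic_atom : ∀ x Q C a, T.Selects x Q C (.pos a) → a.pred ∈ S.probabilistic →
        (∀ α : AtomicChoice P, (AtomicChoice.clause α).head = a →
          T.LabelUnlessBot (.choice α :: x)
            (replaceAt Q (T.sel x) (AtomicChoice.clause α).body) (.and C (.atom α))) ∧
        (∀ α : AtomicChoice P, (AtomicChoice.clause α).head ≠ a →
          T.label (.choice α :: x) = none) ∧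
        (∀ r, T.label (.derived r :: x) = none) ∧
        T.label (.negative :: x) = none)
      (subsidiary : ∀ x Q C a, T.Selects x Q C (.neg a) → IsSLPDNFTree [.pos a] (subs x))
      (negative_literal : ∀ x Q C a, T.Selects x Q C (.neg a) →
        (leaves x).Nodup ∧
        (∀ y D, (y, D) ∈ leaves x ↔ (subs x).IsSuccess y D) ∧
        (∃ Cₐ, IsDnf (.neg (disj ((leaves x).map Prod.snd))) Cₐ ∧
          T.LabelUnlessBot (.negative :: x) (replaceAt Q (T.sel x) []) (.and C Cₐ)) ∧
        (∀ r, T.label (.derived r :: x) = none) ∧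
        (∀ α, T.label (.choice α :: x) = none)) :
      IsSLPDNFTree Q₀ T

/-- `expl(Q)`: the composite choices represented by the success leaves of the main tree. -/
def Tree.expl (T : Tree P) : Set (Set (AtomicChoice P)) :=
  {κ | ∃ x C, T.IsSuccess x C ∧ κ ∈ gamma C}

/-- The worlds `ω_K` identified by a set of composite choices. -/
def worldsOf (K : Set (Set (AtomicChoice P))) : Set (Set (GroundClause S)) :=
  {p | ∃ κ ∈ K, ∃ s, IsSelection s ∧ κ ⊆ s ∧ p = P.world s}

/-- `κ` is an explanation for `Q`: a composite choice such that `Q` is true in the world of every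
selection that extends `κ`. -/
def IsExplanation (κ : Set (AtomicChoice P)) (Q : GroundQuery S) : Prop :=
  Consistent κ ∧ ∀ s, IsSelection s → κ ⊆ s → Satisfies (P.world s) Q

/-- `K` is covering for `Q`: every world in which `Q` is true is identified by `K`. -/
def IsCovering (K : Set (Set (AtomicChoice P))) (Q : GroundQuery S) : Prop :=
  ∀ s, IsSelection s → Satisfies (P.world s) Q → P.world s ∈ worldsOf K

end Trees

end SLPDNF

/-! Fix a selection `s` and read choice expressions as Boolean formulas in which an atomic choice is
true when it belongs to `s` (`ChoiceExpr.Holds`). Then `γ(C)` has a member inside `s` exactly when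
`C` is true (`exists_mem_gamma_subset_iff`), and every `dnf` rewriting step preserves truth
(`IsDnf.holds_iff`). In particular, a node pruned for having value `⊥` is irrelevant to `s`. It
remains to show that `Q` is true in the world of `s` iff some success leaf carries an expression
true under `s` (`IsSLPDNFTree.satisfies_iff`).

This goes by induction on the nesting of subsidiary trees, which makes `Cₐ` true exactly when `a` is
not true in the well-founded model `M`. From a leaf, truth climbs to the root because `M` satisfies
the clauses of the world and is two-valued. Conversely, `M` is stable, so each true atom has a
finite derivation in which negative literals are evaluated in `M`. Whatever literal is selected,
following that derivation leads to a child whose query has a shorter one, so a success leaf is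
reached even in an infinite tree.

Finiteness of `expl` comes from there being only finitely many atomic choices. -/

namespace SLPDNF

universe u v w

/-! ### Finiteness of the set of atomic choices -/

section Finiteness

variable {S : Vocabulary.{u, v, w}}

theorem Atom.finite_vars (a : Atom S (Term S)) : a.vars.Finite := by
  have hsub : a.vars ⊆ ⋃ i, {x | a.args i = .var x} := by
    rintro x ⟨i, hi⟩
    exact Set.mem_iUnion.2 ⟨i, hi⟩
  refine (Set.finite_iUnion fun i => Set.Subsingleton.finite ?_).subset hsub
  intro x hx y hy
  simp only [Set.mem_ofPred_eq] at hx hy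
  rw [hx] at hy
  exact Term.var.inj hy

theorem Literal.finite_vars (l : Literal S (Term S)) : l.vars.Finite := by
  cases l with
  | pos a => exact a.finite_vars
  | neg a => exact a.finite_vars

theorem ProbClause.finite_vars (c : ProbClause S) : c.vars.Finite := by
  have hsub : c.vars ⊆ (⋃ h ∈ {h | h ∈ c.heads}, h.1.vars) ∪ ⋃ l ∈ {l | l ∈ c.body}, l.vars := by
    rintro x (⟨h, hh, hx⟩ | ⟨l, hl, hx⟩)
    · exact Or.inl (Set.mem_biUnion hh hx)
    · exact Or.inr (Set.mem_biUnion hl hx)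
  refine Set.Finite.subset ((Set.Finite.biUnion (List.finite_toSet _) ?_).union
    (Set.Finite.biUnion (List.finite_toSet _) ?_)) hsub
  · exact fun h _ => h.1.finite_vars
  · exact fun l _ => l.finite_vars

/-- A clause has finitely many variables and there are finitely many constants. Both the minimal
elements needed for `mins` and the finiteness of `expl` rest on this. -/
instance AtomicChoice.finite (P : LPAD S) : Finite (AtomicChoice P) := by
  have := S.const_finite
  have hg : Finite (Grounding P) := by
    have : ∀ c : {c // c ∈ P.probClauses}, Finite (c.1.vars → S.Const) := by
      intro c
      have := c.1.finite_vars.to_subtype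
      infer_instance
    infer_instance
  infer_instance

end Finiteness

/-! ### Boolean semantics of choice expressions -/

section Expressions

variable {S : Vocabulary.{u, v, w}} {P : LPAD S}

theorem Consistent.mono {κ s : Set (AtomicChoice P)} (hs : Consistent s) (h : κ ⊆ s) :
    Consistent κ :=
  fun α hα β hβ => hs α (h hα) β (h hβ)

/-- Removal of inconsistent and redundant sets does not change the consistent sets covered. -/
theorem exists_mem_mins_subset_iff {K : Set (Set (AtomicChoice P))} {s : Set (AtomicChoice P)}
    (hs : Consistent s) : (∃ κ ∈ mins K, κ ⊆ s) ↔ ∃ κ ∈ K, κ ⊆ s := by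
  constructor
  · rintro ⟨κ, hκ, h⟩
    exact ⟨κ, hκ.1, h⟩
  · rintro ⟨κ, hκ, h⟩
    -- The family is finite, so it has a minimal member below `κ`; lying inside `s`, that member is
    -- consistent and survives `mins`.
    obtain ⟨μ, hμκ, hμ⟩ := (Set.toFinite K).exists_le_minimal hκ
    have hμs : μ ⊆ s := Set.Subset.trans hμκ h
    exact ⟨μ, ⟨hμ.1, hs.mono hμs, fun κ' hκ' hlt => hlt.not_subset (hμ.2 hκ' hlt.subset)⟩, hμs⟩

/-- A selection omits some choice of `κ` exactly when it contains an alternative to one. -/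
theorem IsSelection.not_subset_iff {s : Set (AtomicChoice P)} (hs : IsSelection s)
    (κ : Set (AtomicChoice P)) : ¬ κ ⊆ s ↔ ∃ β ∈ complChoice κ, β ∈ s := by
  simp only [complChoice, AtomicChoice.compl, Set.mem_iUnion, Set.mem_ofPred_eq, exists_prop]
  constructor
  · intro h
    obtain ⟨α, hα, hαs⟩ := Set.not_subset.1 h
    obtain ⟨β, hβ, hg⟩ := hs.2 α.1
    exact ⟨β, ⟨α, hα, hg.symm, fun h => hαs (h ▸ hβ)⟩, hβ⟩
  · rintro ⟨β, ⟨α, hα, hαβ⟩, hβ⟩ h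
    exact hs.1 α (h hα) β hβ hαβ

theorem exists_mem_hits_subset_iff (𝒮 : Set (Set (AtomicChoice P))) (s : Set (AtomicChoice P)) :
    (∃ H ∈ hits 𝒮, H ⊆ s) ↔ ∀ X ∈ 𝒮, ∃ β ∈ X, β ∈ s := by
  constructor
  · rintro ⟨H, ⟨f, hf, rfl⟩, h⟩ X hX
    exact ⟨f ⟨X, hX⟩, hf ⟨X, hX⟩, h ⟨_, rfl⟩⟩
  · intro h
    choose f hf hfs using fun X : 𝒮 => h X.1 X.2
    exact ⟨Set.range f, ⟨f, hf, rfl⟩, Set.range_subset_iff.2 hfs⟩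

/-- A hitting set of the complements inside `s` gives, for each `κ`, an alternative in `s` to a
choice in `κ`. As `s` decides every grounding, this says precisely that `s` contains no `κ`. -/
theorem exists_mem_duals_subset_iff {K : Set (Set (AtomicChoice P))} {s : Set (AtomicChoice P)}
    (hs : IsSelection s) : (∃ κ ∈ duals K, κ ⊆ s) ↔ ¬ ∃ κ ∈ K, κ ⊆ s := by
  rw [duals, exists_mem_mins_subset_iff hs.1, exists_mem_hits_subset_iff, Set.forall_mem_image]
  push Not
  exact forall₂_congr fun κ _ => (hs.not_subset_iff κ).symm

theorem exists_mem_otimes_subset_iff {K L : Set (Set (AtomicChoice P))}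
    {s : Set (AtomicChoice P)} (hs : Consistent s) :
    (∃ κ ∈ otimes K L, κ ⊆ s) ↔ (∃ κ ∈ K, κ ⊆ s) ∧ ∃ κ ∈ L, κ ⊆ s := by
  rw [otimes, exists_mem_mins_subset_iff hs]
  constructor
  · rintro ⟨_, ⟨κ, hκ, μ, hμ, rfl⟩, h⟩
    exact ⟨⟨κ, hκ, Set.subset_union_left.trans h⟩, ⟨μ, hμ, Set.subset_union_right.trans h⟩⟩
  · rintro ⟨⟨κ, hκ, hκs⟩, ⟨μ, hμ, hμs⟩⟩
    exact ⟨_, ⟨κ, hκ, μ, hμ, rfl⟩, Set.union_subset hκs hμs⟩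

/-- Truth of a choice expression under a set of atomic choices. -/
def ChoiceExpr.Holds (s : Set (AtomicChoice P)) : ChoiceExpr P → Prop
  | .bot => False
  | .top => True
  | .atom α => α ∈ s
  | .neg C => ¬ C.Holds s
  | .and C D => C.Holds s ∧ D.Holds s
  | .or C D => C.Holds s ∨ D.Holds s

theorem exists_mem_gamma_subset_iff {s : Set (AtomicChoice P)} (hs : IsSelection s)
    (C : ChoiceExpr P) : (∃ κ ∈ gamma C, κ ⊆ s) ↔ C.Holds s := by
  induction C with
  | bot => simp [gamma, ChoiceExpr.Holds]
  | top => simp [gamma, ChoiceExpr.Holds]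
  | atom α => simp [gamma, ChoiceExpr.Holds]
  | neg C ih => rw [gamma, exists_mem_duals_subset_iff hs, ih, ChoiceExpr.Holds]
  | and C D ihC ihD =>
    rw [gamma, exists_mem_mins_subset_iff hs.1, exists_mem_otimes_subset_iff hs.1, ihC, ihD,
      ChoiceExpr.Holds]
  | or C D ihC ihD =>
    rw [gamma, exists_mem_mins_subset_iff hs.1, ChoiceExpr.Holds, ← ihC, ← ihD]
    simp only [Set.mem_union, or_and_right, exists_or]

theorem consistent_of_mem_gamma {C : ChoiceExpr P} {κ : Set (AtomicChoice P)}
    (h : κ ∈ gamma C) : Consistent κ := by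
  cases C with
  | bot => exact h.elim
  | top =>
    rw [gamma, Set.mem_singleton_iff] at h
    subst h
    exact fun α hα => hα.elim
  | atom α =>
    rw [gamma, Set.mem_singleton_iff] at h
    subst h
    intro β hβ δ hδ hβδ
    exact hβδ.2 (hβ.trans hδ.symm)
  | neg C => exact h.2.1
  | and C D => exact h.2.1
  | or C D => exact h.2.1

theorem Rewrite.holds_iff {R : ChoiceExpr P → ChoiceExpr P → Prop} {s : Set (AtomicChoice P)}
    (hR : ∀ C D, R C D → (C.Holds s ↔ D.Holds s)) {C D : ChoiceExpr P} (h : Rewrite R C D) :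
    C.Holds s ↔ D.Holds s := by
  induction h with
  | root h => exact hR _ _ h
  | neg _ ih => exact not_congr ih
  | andLeft E _ ih => exact and_congr_left' ih
  | andRight E _ ih => exact and_congr_right' ih
  | orLeft E _ ih => exact or_congr_left ih
  | orRight E _ ih => exact or_congr_right ih

theorem ACEq.holds_iff (s : Set (AtomicChoice P)) {C D : ChoiceExpr P} (h : ACEq C D) :
    C.Holds s ↔ D.Holds s := by
  induction h with
  | rel C D h =>
    refine h.holds_iff ?_
    rintro _ _ (_ | _ | _ | _) <;> simp only [ChoiceExpr.Holds] <;> tauto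
  | refl => rfl
  | symm _ _ _ ih => exact ih.symm
  | trans _ _ _ _ _ ih₁ ih₂ => exact ih₁.trans ih₂

/-- Consistency matters only for the two rules about alternatives; the others are propositional
tautologies. -/
theorem MinsRule.holds_iff {s : Set (AtomicChoice P)} (hs : Consistent s) {C D : ChoiceExpr P}
    (h : MinsRule C D) : C.Holds s ↔ D.Holds s := by
  cases h with
  | clash α β h => exact ⟨fun h' => hs α h'.1 β h'.2 h, False.elim⟩
  | specific α β h => exact ⟨And.left, fun hα => ⟨hα, fun hβ => hs α hα β hβ h⟩⟩
  | _ => simp only [ChoiceExpr.Holds]; tauto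

theorem DnfRule.holds_iff (s : Set (AtomicChoice P)) {C D : ChoiceExpr P} (h : DnfRule C D) :
    C.Holds s ↔ D.Holds s := by
  cases h <;> simp only [ChoiceExpr.Holds] <;> tauto

theorem MinsStep.holds_iff {s : Set (AtomicChoice P)} (hs : Consistent s) {C D : ChoiceExpr P}
    (h : MinsStep C D) : C.Holds s ↔ D.Holds s := by
  obtain ⟨C', D', h₁, h₂, h₃⟩ := h
  exact (h₁.holds_iff s).trans
    ((h₂.holds_iff fun _ _ => MinsRule.holds_iff hs).trans (h₃.holds_iff s))

theorem holds_iff_of_reflTransGen {R : ChoiceExpr P → ChoiceExpr P → Prop}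
    {s : Set (AtomicChoice P)} (hR : ∀ C D, R C D → (C.Holds s ↔ D.Holds s))
    {C D : ChoiceExpr P} (h : Relation.ReflTransGen R C D) : C.Holds s ↔ D.Holds s := by
  induction h with
  | refl => rfl
  | tail _ h ih => exact ih.trans (hR _ _ h)

theorem IsDnf.holds_iff {s : Set (AtomicChoice P)} (hs : Consistent s) {C D : ChoiceExpr P}
    (h : IsDnf C D) : D.Holds s ↔ C.Holds s := by
  obtain ⟨C', h₁, h₂⟩ := h
  exact ((holds_iff_of_reflTransGen
    (fun _ _ h => h.holds_iff fun _ _ => DnfRule.holds_iff s) h₁.1).trans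
    (holds_iff_of_reflTransGen (fun _ _ => MinsStep.holds_iff hs) h₂.1)).symm

theorem holds_disj_iff (s : Set (AtomicChoice P)) (L : List (ChoiceExpr P)) :
    (disj L).Holds s ↔ ∃ C ∈ L, C.Holds s := by
  induction L with
  | nil => simp [disj, ChoiceExpr.Holds]
  | cons C L ih =>
    cases L with
    | nil => simp [disj]
    | cons D L => simp only [disj, ChoiceExpr.Holds, ih, List.mem_cons, exists_eq_or_imp]

end Expressions

/-! ### Finite derivations and the well-founded model -/

section Models

variable {S : Vocabulary.{u, v, w}}

/-- The query `Q` has a derivation with `n` steps from `p`, in which negative literals are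
evaluated in `M`. -/
inductive Derives (p : Set (GroundClause S)) (M : Set (GroundAtom S)) : ℕ → GroundQuery S → Prop
  | nil : Derives p M 0 []
  | neg {a n Q} : a ∉ M → Derives p M n Q → Derives p M (n + 1) (.neg a :: Q)
  | pos {r m n Q} : r ∈ p → Derives p M m r.body → Derives p M n Q →
      Derives p M (m + n + 1) (.pos r.head :: Q)

variable {p : Set (GroundClause S)} {M : Set (GroundAtom S)}

theorem Derives.append {m n : ℕ} {A B : GroundQuery S} (hA : Derives p M m A)
    (hB : Derives p M n B) : Derives p M (m + n) (A ++ B) := by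
  induction hA with
  | nil => simpa using hB
  | neg ha _ ih =>
    rw [Nat.add_right_comm]
    exact .neg ha ih
  | @pos _ m _ _ hr hb _ _ ih =>
    rw [Nat.add_right_comm, Nat.add_assoc m]
    exact .pos hr hb ih

/-- Literals of a query are derived independently and step counts add exactly, so any literal can be
singled out. This makes the selection rule immaterial. -/
theorem Derives.of_append {k : ℕ} {A B : GroundQuery S} (h : Derives p M k (A ++ B)) :
    ∃ m n, k = m + n ∧ Derives p M m A ∧ Derives p M n B := by
  induction A generalizing k with
  | nil => exact ⟨0, k, (Nat.zero_add k).symm, .nil, h⟩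
  | cons l A ih =>
    cases h with
    | neg ha h =>
      obtain ⟨m, n, rfl, h₁, h₂⟩ := ih h
      exact ⟨m + 1, n, by omega, .neg ha h₁, h₂⟩
    | pos hr hb h =>
      obtain ⟨m, n, rfl, h₁, h₂⟩ := ih h
      exact ⟨_, n, by omega, .pos hr hb h₁, h₂⟩

theorem exists_derives {Q : GroundQuery S} (h : ∀ l ∈ Q, ∃ n, Derives p M n [l]) :
    ∃ n, Derives p M n Q := by
  induction Q with
  | nil => exact ⟨0, .nil⟩
  | cons l Q ih =>
    obtain ⟨m, hm⟩ := h l List.mem_cons_self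
    obtain ⟨n, hn⟩ := ih fun l' hl' => h l' (List.mem_cons_of_mem l hl')
    exact ⟨m + n, hm.append hn⟩

/-- The derivable atoms form a model of the reduct, so they include its least model. -/
theorem exists_derives_of_mem_leastModel {a : GroundAtom S}
    (ha : a ∈ leastModel (reduct p M)) : ∃ n, Derives p M n [.pos a] := by
  refine Set.mem_sInter.1 ha {b | ∃ n, Derives p M n [.pos b]} ?_
  rintro _ ⟨r, hr, hneg, rfl⟩ hbody
  obtain ⟨n, hn⟩ : ∃ n, Derives p M n r.body := by
    refine exists_derives fun l hl => ?_
    cases l with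
    | pos b => exact hbody (.pos b) (List.mem_filter.2 ⟨hl, rfl⟩)
    | neg b => exact ⟨_, .neg (hneg b hl) .nil⟩
  exact ⟨_, .pos (r := r) hr hn .nil⟩

theorem eq_append_replaceAt {Q : GroundQuery S} {k : ℕ} {l : GroundLiteral S}
    (h : Q[k]? = some l) : Q = Q.take k ++ l :: Q.drop (k + 1) := by
  obtain ⟨hk, rfl⟩ := List.getElem?_eq_some_iff.1 h
  rw [List.getElem_cons_drop, List.take_append_drop]

/-- Putting the derivation of the clause body in place of that of the selected atom saves the one
step that applied the clause. -/
theorem Derives.resolve_pos {n k : ℕ} {Q : GroundQuery S} {a : GroundAtom S}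
    (h : Derives p M n Q) (hl : Q[k]? = some (.pos a)) :
    ∃ r ∈ p, r.head = a ∧ ∃ m < n, Derives p M m (replaceAt Q k r.body) := by
  rw [eq_append_replaceAt hl] at h
  obtain ⟨i, j, rfl, hA, hB⟩ := h.of_append
  cases hB with
  | @pos r m j _ hr hb hB =>
    exact ⟨r, hr, rfl, i + m + j, by omega, (hA.append hb).append hB⟩

theorem Derives.resolve_neg {n k : ℕ} {Q : GroundQuery S} {a : GroundAtom S}
    (h : Derives p M n Q) (hl : Q[k]? = some (.neg a)) :
    a ∉ M ∧ ∃ m < n, Derives p M m (replaceAt Q k []) := by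
  rw [eq_append_replaceAt hl] at h
  obtain ⟨i, j, rfl, hA, hB⟩ := h.of_append
  cases hB with
  | @neg _ j _ ha hB =>
    exact ⟨ha, i + j, by omega, (hA.append .nil).append hB⟩

theorem wfOp_wfm (p : Set (GroundClause S)) : wfOp p (wfm p) = wfm p := OrderHom.map_lfp _

/-- The well-founded model satisfies every clause of the program. -/
theorem Satisfies.head_mem {r : GroundClause S} (hr : r ∈ p) (h : Satisfies p r.body) :
    r.head ∈ (wfm p).1 := by
  rw [← wfOp_wfm]
  exact ⟨r, hr, rfl, h⟩

theorem Satisfies.of_replaceAt {Q B : GroundQuery S} {k : ℕ} {l : GroundLiteral S}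
    (hl : Q[k]? = some l) (h : Satisfies p (replaceAt Q k B))
    (hB : Satisfies p B → l.TrueIn (wfm p)) : Satisfies p Q := by
  rw [eq_append_replaceAt hl]
  simp only [Satisfies, replaceAt, List.mem_append, List.mem_cons] at h hB ⊢
  rintro l' (h' | rfl | h')
  · exact h l' (Or.inl (Or.inl h'))
  · exact hB fun l' h' => h l' (Or.inl (Or.inr h'))
  · exact h l' (Or.inr h')

/-- Stability supplies derivations of the true atoms; two-valuedness turns falsity of an atom into
its absence from the model. -/
theorem exists_derives_of_satisfies {Q : GroundQuery S}
    (htotal : (wfm p).2 = (wfm p).1ᶜ) (hstable : IsStableModel p (wfm p).1)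
    (h : Satisfies p Q) : ∃ n, Derives p (wfm p).1 n Q := by
  refine exists_derives fun l hl => ?_
  have hl := h l hl
  cases l with
  | pos a =>
    refine exists_derives_of_mem_leastModel ?_
    rw [← hstable]
    exact hl
  | neg a =>
    have ha : a ∈ (wfm p).2 := hl
    rw [htotal] at ha
    exact ⟨_, .neg ha .nil⟩

end Models

/-! ### Soundness and completeness of SLPDNF-trees -/

section Trees

variable {S : Vocabulary.{u, v, w}} {P : LPAD S}

theorem AtomicChoice.head_pred_mem (α : AtomicChoice P) :
    (AtomicChoice.clause α).head.pred ∈ S.probabilistic :=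
  P.prob_heads _ α.1.1.2 _ (List.get_mem _ _)

theorem LPAD.head_pred_notMem {r : GroundClause S} (hr : r ∈ P.groundDerived) :
    r.head.pred ∉ S.probabilistic := by
  obtain ⟨c, hc, ν, rfl⟩ := hr
  exact P.derived_heads c hc

theorem Tree.LabelUnlessBot.of_some {T : Tree P} {x : Address P} {Q Q' : GroundQuery S}
    {C C' : ChoiceExpr P} {s : Set (AtomicChoice P)} (hs : Consistent s)
    (h : T.LabelUnlessBot x Q C) (hx : T.label x = some ⟨Q', C'⟩) (hC : C'.Holds s) :
    Q' = Q ∧ C.Holds s := by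
  obtain ⟨D, hD, ⟨-, h⟩ | ⟨-, h⟩⟩ := h
  · rw [h] at hx
    cases hx
  · rw [h] at hx
    cases hx
    exact ⟨rfl, (hD.holds_iff hs).1 hC⟩

/-- Simplification preserves truth under `s`, so a true expression cannot become `⊥` and its node is
not pruned. -/
theorem Tree.LabelUnlessBot.exists_label {T : Tree P} {x : Address P} {Q : GroundQuery S}
    {C : ChoiceExpr P} {s : Set (AtomicChoice P)} (hs : Consistent s)
    (h : T.LabelUnlessBot x Q C) (hC : C.Holds s) :
    ∃ C', T.label x = some ⟨Q, C'⟩ ∧ C'.Holds s := by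
  obtain ⟨D, hD, ⟨rfl, -⟩ | ⟨-, h⟩⟩ := h
  · exact ((hD.holds_iff hs).2 hC).elim
  · exact ⟨D, h, (hD.holds_iff hs).2 hC⟩

/-- A query is true in the world of a selection exactly when the selection satisfies the
expression of some success leaf. -/
theorem IsSLPDNFTree.satisfies_iff {s : Set (AtomicChoice P)} (hP : P.Sound)
    (hs : IsSelection s) {Q : GroundQuery S} {T : Tree P} (hT : IsSLPDNFTree Q T) :
    Satisfies (P.world s) Q ↔ ∃ x C, T.IsSuccess x C ∧ C.Holds s := by
  obtain ⟨htotal, hstable⟩ := hP s hs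
  induction hT with
  | mk Q₀ T subs leaves root orphan success selected derived_atom probabilistic_atom subsidiary
    negative_literal ih =>
  -- By the induction hypothesis, the success leaves of the subsidiary tree decide `a` in this
  -- world.
  have not_mem_iff : ∀ {x Q C a Cₐ}, T.Selects x Q C (.neg a) →
      IsDnf (.neg (disj ((leaves x).map Prod.snd))) Cₐ →
      (Cₐ.Holds s ↔ a ∉ (wfm (P.world s)).1) := by
    intro x Q C a Cₐ hsel hCₐ
    have hsat : a ∈ (wfm (P.world s)).1 ↔ Satisfies (P.world s) [.pos a] := by
      simp [Satisfies, Literal.TrueIn]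
    rw [hCₐ.holds_iff hs.1, ChoiceExpr.Holds, holds_disj_iff, hsat, ih x Q C a hsel, not_iff_not]
    simp only [← (negative_literal x Q C a hsel).2.1, List.mem_map, Prod.exists,
      exists_eq_right]
    exact ⟨fun ⟨D, ⟨y, hy⟩, hD⟩ => ⟨y, D, hy, hD⟩, fun ⟨y, D, hy, hD⟩ => ⟨D, ⟨y, hy⟩, hD⟩⟩
  constructor
  -- Completeness: the tree may have infinite branches, so the induction is on the length of a
  -- derivation of the node's query.
  · suffices H : ∀ n x Q C, T.label x = some ⟨Q, C⟩ → C.Holds s →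
        Derives (P.world s) (wfm (P.world s)).1 n Q → ∃ x C, T.IsSuccess x C ∧ C.Holds s by
      intro h
      obtain ⟨n, hn⟩ := exists_derives_of_satisfies htotal ((hstable _).2 rfl) h
      exact H n [] Q₀ .top root trivial hn
    intro n
    induction n using Nat.strong_induction_on with
    | _ n IH =>
    intro x Q C hx hC hQ
    by_cases hQ₀ : Q = []
    · subst hQ₀
      exact ⟨x, C, hx, hC⟩
    obtain ⟨l, hsel⟩ := selected x Q C hx hQ₀
    cases l with
    | pos a =>
      obtain ⟨r, hr, rfl, m, hm, hd⟩ := hQ.resolve_pos hsel.2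
      -- The clause used by the derivation names the child to follow; the predicate of its head
      -- tells which expansion rule applies.
      rcases hr with ⟨α, hα, rfl⟩ | hr
      · obtain ⟨C', hx', hC'⟩ := ((probabilistic_atom x Q C _ hsel α.head_pred_mem).1 α
          rfl).exists_label hs.1 ⟨hC, hα⟩
        exact IH m hm _ _ C' hx' hC' hd
      · exact IH m hm _ _ C
          ((derived_atom x Q C _ hsel (LPAD.head_pred_notMem hr)).1 r hr rfl) hC hd
    | neg a =>
      obtain ⟨ha, m, hm, hd⟩ := hQ.resolve_neg hsel.2
      obtain ⟨-, -, ⟨Cₐ, hCₐ, hlab⟩, -⟩ := negative_literal x Q C a hsel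
      obtain ⟨C', hx', hC'⟩ := hlab.exists_label hs.1 ⟨hC, (not_mem_iff hsel hCₐ).2 ha⟩
      exact IH m hm _ _ C' hx' hC' hd
  -- Soundness: every node has finite depth, so truth is carried to the root by induction on the
  -- address. Truth of a child's expression implies truth of its parent's.
  · suffices H : ∀ x Q C, T.label x = some ⟨Q, C⟩ → C.Holds s → Satisfies (P.world s) Q →
        Satisfies (P.world s) Q₀ by
      rintro ⟨x, C, hx, hC⟩
      exact H x [] C hx hC fun l hl => absurd hl List.not_mem_nil
    intro x
    induction x with
    | nil =>
      intro Q C hx _ hQ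
      rw [root] at hx
      cases hx
      exact hQ
    | cons e x IH =>
      intro Q' C' hx' hC' hQ'
      rcases hx : T.label x with _ | ⟨Q, C⟩
      · rw [orphan x e hx] at hx'
        cases hx'
      by_cases hQ₀ : Q = []
      · subst hQ₀
        rw [success x C e hx] at hx'
        cases hx'
      obtain ⟨l, hsel⟩ := selected x Q C hx hQ₀
      cases l with
      | pos a =>
        by_cases hpred : a.pred ∈ S.probabilistic
        · obtain ⟨hsome, hnone, hder, hneg⟩ := probabilistic_atom x Q C a hsel hpred
          cases e with
          | derived r => rw [hder] at hx'; cases hx'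
          | negative => rw [hneg] at hx'; cases hx'
          | choice α =>
            by_cases hhead : (AtomicChoice.clause α).head = a
            · obtain ⟨rfl, hC, hα⟩ := (hsome α hhead).of_some hs.1 hx' hC'
              refine IH Q C hx hC (hQ'.of_replaceAt hsel.2 fun hB => ?_)
              rw [← hhead]
              exact hB.head_mem (Or.inl ⟨α, hα, rfl⟩)
            · rw [hnone α hhead] at hx'
              cases hx'
        · obtain ⟨hsome, hnone, hch, hneg⟩ := derived_atom x Q C a hsel hpred
          cases e with
          | choice α => rw [hch] at hx'; cases hx'
          | negative => rw [hneg] at hx'; cases hx'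
          | derived r =>
            by_cases hr : r ∈ P.groundDerived ∧ r.head = a
            · rw [hsome r hr.1 hr.2] at hx'
              cases hx'
              refine IH Q C' hx hC' (hQ'.of_replaceAt hsel.2 fun hB => ?_)
              rw [← hr.2]
              exact hB.head_mem (Or.inr hr.1)
            · rw [hnone r hr] at hx'
              cases hx'
      | neg a =>
        obtain ⟨-, -, ⟨Cₐ, hCₐ, hlab⟩, hder, hch⟩ := negative_literal x Q C a hsel
        cases e with
        | derived r => rw [hder] at hx'; cases hx'
        | choice α => rw [hch] at hx'; cases hx'
        | negative =>
          obtain ⟨rfl, hC, hCa⟩ := hlab.of_some hs.1 hx' hC'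
          refine IH Q C hx hC (hQ'.of_replaceAt hsel.2 fun _ => ?_)
          change a ∈ (wfm (P.world s)).2
          rw [htotal]
          exact (not_mem_iff hsel hCₐ).1 hCa

theorem IsSLPDNFTree.satisfies_iff_exists_mem_expl {s : Set (AtomicChoice P)} (hP : P.Sound)
    (hs : IsSelection s) {Q : GroundQuery S} {T : Tree P} (hT : IsSLPDNFTree Q T) :
    Satisfies (P.world s) Q ↔ ∃ κ ∈ T.expl, κ ⊆ s := by
  rw [hT.satisfies_iff hP hs]
  constructor
  · rintro ⟨x, C, hx, hC⟩
    obtain ⟨κ, hκ, hκs⟩ := (exists_mem_gamma_subset_iff hs C).2 hC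
    exact ⟨κ, ⟨x, C, hx, hκ⟩, hκs⟩
  · rintro ⟨κ, ⟨x, C, hx, hκ⟩, hκs⟩
    exact ⟨x, C, hx, (exists_mem_gamma_subset_iff hs C).1 ⟨κ, hκ, hκs⟩⟩

end Trees

end SLPDNF

theorem theorem1 {S : SLPDNF.Vocabulary} (P : SLPDNF.LPAD S) (hP : P.Sound)
    (Q : SLPDNF.GroundQuery S) (T : SLPDNF.Tree P) (hT : SLPDNF.IsSLPDNFTree Q T) :
    (∀ s : Set (SLPDNF.AtomicChoice P), SLPDNF.IsSelection s →
      (SLPDNF.Satisfies (P.world s) Q ↔ ∃ κ ∈ T.expl, κ ⊆ s)) ∧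
    T.expl.Finite ∧
    (∀ κ ∈ T.expl, SLPDNF.IsExplanation κ Q) ∧
    SLPDNF.IsCovering T.expl Q := by
  -- There may be infinitely many success leaves, but only finitely many sets of atomic choices.
  refine ⟨fun s hs => hT.satisfies_iff_exists_mem_expl hP hs, Set.toFinite _, ?_, ?_⟩
  · rintro κ hκ
    refine ⟨?_, fun s hs hκs => (hT.satisfies_iff_exists_mem_expl hP hs).2 ⟨κ, hκ, hκs⟩⟩
    obtain ⟨x, C, -, hκC⟩ := hκ
    exact SLPDNF.consistent_of_mem_gamma hκC
  · intro s hs h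
    obtain ⟨κ, hκ, hκs⟩ := (hT.satisfies_iff_exists_mem_expl hP hs).1 h
    exact ⟨κ, hκ, s, hs, hκs, rfl⟩
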